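/- Let $n\ge 0$ and let $W$ be a Coxeter group with simple reflections $s_1,\dots,s_n$, that is, $W$ is presented by the generators $s_1,\dots,s_n$ and the relations $(s_is_j)^{m_{ij}}=1$ for all $i,j$ with $m_{ij}<\infty$, where $m_{ii}=1$ and $m_{ij}=m_{ji}\in\{2,3,\dots\}\cup\{\infty\}$ for $i\neq j$. Let $C=s_1s_2\cdots s_n$. A reflection is an element of $W$ conjugate to some $s_i$. The braid group $B_n$ on $n$ strands, with standard generators $\sigma_1,\dots,\sigma_{n-1}$, acts on the sequences of $n$ elements of $W$ by \[ \sigma_i(g_1,\dots,g_n)=(g_1,\dots,g_{i-1},\,g_ig_{i+1}g_i^{-1},\,g_i,\,g_{i+2},\dots,g_n). \] Let $m\le n$ and let $t_1,\dots,t_m$ be reflections such that $t_mt_{m-1}\cdots t_1=C$. Then $m=n$, and there is an element of $B_n$ which transforms the sequence $(t_n,\dots,t_2,t_1)$ into $(s_1,s_2,\dots,s_n)$. That is, the action of $B_n$ restricts to a transitive action on the (nonempty) set of all sequences $(r_1,\dots,r_n)$ of $n$ reflections with $r_1r_2\cdots r_n=C$. -/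

import Mathlib

/-- The defining relators of the braid group on `m` strands, in the generators
`σ_i`, `i : Fin (m - 1)` (indexed from `0`): `σ_i σ_{i+1} σ_i = σ_{i+1} σ_i σ_{i+1}`, and
`σ_i σ_j = σ_j σ_i` for `|i - j| ≥ 2`. -/
def braidRelations (m : ℕ) : Set (FreeGroup (Fin (m - 1))) :=
  {r | ∃ i j : Fin (m - 1), i.val + 1 = j.val ∧
      r = FreeGroup.of i * FreeGroup.of j * FreeGroup.of i *
        (FreeGroup.of j * FreeGroup.of i * FreeGroup.of j)⁻¹} ∪
  {r | ∃ i j : Fin (m - 1), i.val + 1 < j.val ∧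
      r = FreeGroup.of i * FreeGroup.of j * (FreeGroup.of j * FreeGroup.of i)⁻¹}

/-- The braid group on `m` strands (Artin's presentation). -/
abbrev BraidGroup (m : ℕ) : Type := PresentedGroup (braidRelations m)

section Hurwitz

variable {G : Type*} [Group G] {m : ℕ}

/-- The left one, `i`, of the two positions on which the generator `σ_i` acts. -/
def braidLeft (i : Fin (m - 1)) : Fin m := ⟨i.val, by omega⟩

/-- The right one, `i + 1`, of the two positions on which the generator `σ_i` acts. -/
def braidRight (i : Fin (m - 1)) : Fin m := ⟨i.val + 1, by omega⟩

/-- The Hurwitz move `(…, g_i, g_{i+1}, …) ↦ (…, g_i g_{i+1} g_i⁻¹, g_i, …)`. -/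
def hurwitzMove (i : Fin (m - 1)) (g : Fin m → G) : Fin m → G := fun k =>
  if k = braidLeft i then g (braidLeft i) * g (braidRight i) * (g (braidLeft i))⁻¹
  else if k = braidRight i then g (braidLeft i)
  else g k

/-- The inverse move `(…, g_i, g_{i+1}, …) ↦ (…, g_{i+1}, g_{i+1}⁻¹ g_i g_{i+1}, …)`. -/
def hurwitzMoveInv (i : Fin (m - 1)) (g : Fin m → G) : Fin m → G := fun k =>
  if k = braidLeft i then g (braidRight i)
  else if k = braidRight i then (g (braidRight i))⁻¹ * g (braidLeft i) * g (braidRight i)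
  else g k

/-- The Hurwitz move as a permutation of the set of sequences of length `m` in `G`. -/
def hurwitzPerm (i : Fin (m - 1)) : Equiv.Perm (Fin m → G) where
  toFun := hurwitzMove i
  invFun := hurwitzMoveInv i
  left_inv g := by
    have h : braidRight i ≠ braidLeft i := by simp [braidRight, braidLeft]
    funext k
    by_cases h1 : k = braidLeft i
    · simp [hurwitzMove, hurwitzMoveInv, h1, h]
    · by_cases h2 : k = braidRight i
      · simp [hurwitzMove, hurwitzMoveInv, h2, h, mul_assoc]
      · simp [hurwitzMove, hurwitzMoveInv, h1, h2]
  right_inv g := by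
    have h : braidRight i ≠ braidLeft i := by simp [braidRight, braidLeft]
    funext k
    by_cases h1 : k = braidLeft i
    · simp [hurwitzMove, hurwitzMoveInv, h1, h, mul_assoc]
    · by_cases h2 : k = braidRight i
      · simp [hurwitzMove, hurwitzMoveInv, h2, h]
      · simp [hurwitzMove, hurwitzMoveInv, h1, h2]

theorem hurwitzPerm_braid (i j : Fin (m - 1)) (hij : i.val + 1 = j.val) :
    (hurwitzPerm i * hurwitzPerm j * hurwitzPerm i : Equiv.Perm (Fin m → G)) =
      hurwitzPerm j * hurwitzPerm i * hurwitzPerm j := by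
  have e : braidRight i = braidLeft j := by simp [braidRight, braidLeft, hij]
  have a : braidLeft j ≠ braidLeft i := by
    simp only [braidLeft, ne_eq, Fin.mk.injEq]; omega
  have b : braidRight j ≠ braidLeft i := by
    simp only [braidLeft, braidRight, ne_eq, Fin.mk.injEq]; omega
  have c : braidRight j ≠ braidLeft j := by simp [braidRight, braidLeft]
  ext g k
  change hurwitzMove i (hurwitzMove j (hurwitzMove i g)) k =
    hurwitzMove j (hurwitzMove i (hurwitzMove j g)) k
  by_cases h1 : k = braidLeft i
  · subst h1; simp [hurwitzMove, e, a, b, c, a.symm, b.symm, c.symm, mul_assoc]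
  · by_cases h2 : k = braidLeft j
    · subst h2; simp [hurwitzMove, e, a, b, c, a.symm, b.symm, c.symm]
    · by_cases h3 : k = braidRight j
      · subst h3; simp [hurwitzMove, e, a, b, c, a.symm, b.symm, c.symm]
      · simp [hurwitzMove, e, h1, h2, h3]

theorem hurwitzPerm_comm (i j : Fin (m - 1)) (hij : i.val + 1 < j.val) :
    (hurwitzPerm i * hurwitzPerm j : Equiv.Perm (Fin m → G)) =
      hurwitzPerm j * hurwitzPerm i := by
  have a : braidLeft j ≠ braidLeft i := by
    simp only [braidLeft, ne_eq, Fin.mk.injEq]; omega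
  have b : braidRight j ≠ braidLeft i := by
    simp only [braidLeft, braidRight, ne_eq, Fin.mk.injEq]; omega
  have c : braidLeft j ≠ braidRight i := by
    simp only [braidLeft, braidRight, ne_eq, Fin.mk.injEq]; omega
  have d : braidRight j ≠ braidRight i := by
    simp only [braidRight, ne_eq, Fin.mk.injEq]; omega
  ext g k
  change hurwitzMove i (hurwitzMove j g) k = hurwitzMove j (hurwitzMove i g) k
  by_cases h1 : k = braidLeft i
  · subst h1; simp [hurwitzMove, a.symm, b.symm, c.symm, d.symm]
  · by_cases h2 : k = braidRight i
    · subst h2; simp [hurwitzMove, a.symm, b.symm, c.symm, d.symm]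
    · simp [hurwitzMove, a, b, c, d, h1, h2]

/-- The Hurwitz (left) action of the braid group on `m` strands on the sequences of length `m` in
a group: the generator `σ_i` acts as the move
`(…, g_i, g_{i+1}, …) ↦ (…, g_i g_{i+1} g_i⁻¹, g_i, …)`. -/
def hurwitzAction (G : Type*) [Group G] (m : ℕ) : BraidGroup m →* Equiv.Perm (Fin m → G) :=
  PresentedGroup.toGroup (f := hurwitzPerm) (by
    rintro r (⟨i, j, hij, rfl⟩ | ⟨i, j, hij, rfl⟩)
    · simp only [map_mul, map_inv, FreeGroup.lift_apply_of]
      exact mul_inv_eq_one.mpr (hurwitzPerm_braid i j hij)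
    · simp only [map_mul, map_inv, FreeGroup.lift_apply_of]
      exact mul_inv_eq_one.mpr (hurwitzPerm_comm i j hij))

end Hurwitz

namespace CoxeterSystem

variable {n : ℕ} {M : CoxeterMatrix (Fin n)} {W : Type*} [Group W]

/-- The Coxeter element `s_1 s_2 ⋯ s_n`, the product of the simple reflections in the given
order. -/
def coxeterElement (cs : CoxeterSystem M W) : W := (List.ofFn cs.simple).prod

/-- The set of sequences `(r_1, …, r_m)` of `m` reflections with `r_1 r_2 ⋯ r_m = w`. -/
def reflectionFactorizations (cs : CoxeterSystem M W) (m : ℕ) (w : W) : Set (Fin m → W) :=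
  {r | (∀ i, cs.IsReflection (r i)) ∧ (List.ofFn r).prod = w}

end CoxeterSystem

/-!
A factorization `w = r₁ ⋯ r_m` into reflections is viewed as the path `1, r₁, r₁ r₂, …, w`. A Hurwitz
move at the factors `r_k, r_{k+1}` changes just one vertex of this path, within a coset of the
dihedral group `⟨r_k, r_{k+1}⟩`. If that vertex is a peak, that is, longer than both of its
neighbours, and `r_k ≠ r_{k+1}`, then some sequence of moves replaces it by a shorter vertex
(`exists_length_mul_lt_max`). Hence every factorization is Hurwitz equivalent to one that has two
equal adjacent factors, or whose path has no peaks (`exists_isPeakless_or_repeat`). A path without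
peaks only goes up, since it starts at `1`.

Let `w` be the product of a word `ω` with distinct letters, such as `s_1 ⋯ s_n`. Along a path without
peaks the last step down from `w` deletes one letter of `ω`, by the strong exchange property
(`IsReflection.strong_exchange`), and what is left is again a word with distinct letters. Such a
word has product `1` only if it is empty (`eq_nil_of_nodup_of_wordProd_eq_one`), so the path has
exactly `|ω|` steps, and by induction the factorization is Hurwitz equivalent to `ω`: the last
reflection moves to the place of the deleted letter. If there are two equal adjacent factors instead,
cancelling them gives a factorization with fewer than `|ω|` factors, which cannot exist, by
induction (`hurwitzEquiv_of_length_le`).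

Both facts about Coxeter groups come from actions. The strong exchange property is read off from the
action on signed group elements, which defines the cocycle `inversionParity`. That a simple
reflection is not a product of others is seen in the geometric representation.
-/

/-! ### Inversion parity and the strong exchange property -/

namespace CoxeterSystem

open List

section InversionParity

variable {B : Type*} {M : CoxeterMatrix B} {W : Type*} [Group W] (cs : CoxeterSystem M W)

theorem functionEnd_mul_apply {α : Type*} (f g : Function.End α) (a : α) :
    (f * g) a = f (g a) := rfl

open Classical in
/-- The action of a simple reflection `s` on pairs `(t, ε)`: conjugate `t` by `s`, and flip the
sign `ε` exactly when `t = s`. -/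
noncomputable def signedConj (i : B) : Function.End (W × ZMod 2) := fun p =>
  (cs.simple i * p.1 * (cs.simple i)⁻¹, p.2 + if p.1 = cs.simple i then 1 else 0)

open Classical in
/-- Under the first `2k` letters of the word `⋯ sᵢ sⱼ sᵢ sⱼ`, applied from the right, the sign is
flipped once for each `l < 2k` such that `t = (sᵢ sⱼ)⁻ˡ sⱼ`. -/
theorem signedConj_mul_pow_apply (i j : B) (k : ℕ) (t : W) (e : ZMod 2) :
    ((cs.signedConj i * cs.signedConj j) ^ k) (t, e) =
      ((cs.simple i * cs.simple j) ^ k * t * ((cs.simple i * cs.simple j) ^ k)⁻¹,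
        e + ∑ l ∈ Finset.range (2 * k),
          if t = ((cs.simple i * cs.simple j) ^ l)⁻¹ * cs.simple j then 1 else 0) := by
  induction k with
  | zero => simp; rfl
  | succ k ih =>
    set c := cs.simple i * cs.simple j with hc
    have hconj : cs.simple j * c * (cs.simple j)⁻¹ = c⁻¹ := by simp [hc, mul_assoc]
    have hk : ∀ k : ℕ, (c ^ k)⁻¹ * cs.simple j = cs.simple j * c ^ k := fun k => by
      rw [← inv_pow, ← hconj, conj_pow]; group
    have h1 : c ^ k * t * (c ^ k)⁻¹ = cs.simple j ↔ t = (c ^ (2 * k))⁻¹ * cs.simple j := by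
      rw [two_mul, pow_add, mul_inv_rev, mul_assoc (c ^ k)⁻¹, hk, eq_inv_mul_iff_mul_eq,
        mul_inv_eq_iff_eq_mul]
    have h2 : cs.simple j * (c ^ k * t * (c ^ k)⁻¹) * (cs.simple j)⁻¹ = cs.simple i ↔
        t = (c ^ (2 * k + 1))⁻¹ * cs.simple j := by
      have : (c ^ (2 * k + 1))⁻¹ * cs.simple j =
          (c ^ k)⁻¹ * ((cs.simple j)⁻¹ * cs.simple i * cs.simple j) * c ^ k := by
        have h3 : (c ^ (k + 1))⁻¹ * cs.simple j =
            (cs.simple j)⁻¹ * cs.simple i * cs.simple j * c ^ k := by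
          rw [hk, pow_succ', hc]; simp [mul_assoc]
        rw [show 2 * k + 1 = (k + 1) + k by omega, pow_add, mul_inv_rev, mul_assoc, h3, mul_assoc]
        group
      rw [this]
      constructor
      · intro h; rw [← h]; group
      · intro h; rw [h]; group
    rw [pow_succ', functionEnd_mul_apply, ih, functionEnd_mul_apply,
      show 2 * (k + 1) = 2 * k + 1 + 1 by ring, Finset.sum_range_succ, Finset.sum_range_succ]
    simp only [signedConj, h1, h2]
    refine Prod.ext ?_ ?_
    · simp only [pow_succ', hc, mul_inv_rev, mul_assoc]
    · simp only [add_assoc]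

theorem isLiftable_signedConj : M.IsLiftable cs.signedConj := by
  classical
  intro i j
  funext p
  obtain ⟨t, e⟩ := p
  rw [signedConj_mul_pow_apply, two_mul, Finset.sum_range_add]
  have h := cs.simple_mul_simple_pow i j
  -- the summand is periodic with period `M i j`, so every term occurs twice
  simp only [pow_add, h, one_mul, CharTwo.add_self_eq_zero]
  simp; rfl

/-- The parity (as an element of `ZMod 2`) with which `t` occurs in the right inversion sequence of
a word for `w`. It is read off from the action of `W` on `W × ZMod 2` extending `signedConj`, so it
does not depend on the word. -/
noncomputable def inversionParity (w t : W) : ZMod 2 :=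
  (cs.lift ⟨cs.signedConj, cs.isLiftable_signedConj⟩ w (t, 0)).2

open Classical in
theorem lift_signedConj_apply (w t : W) (e : ZMod 2) :
    cs.lift ⟨cs.signedConj, cs.isLiftable_signedConj⟩ w (t, e) =
      (w * t * w⁻¹, e + cs.inversionParity w t) := by
  suffices h : ∀ w : W, ∃ a : ZMod 2, ∀ e,
      cs.lift ⟨cs.signedConj, cs.isLiftable_signedConj⟩ w (t, e) = (w * t * w⁻¹, e + a) by
    obtain ⟨a, ha⟩ := h w
    rw [inversionParity, ha, ha, zero_add]
  intro w
  induction w using cs.simple_induction_left with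
  | one => exact ⟨0, fun e => by simp; rfl⟩
  | mul_simple_left w i ih =>
    obtain ⟨a, ha⟩ := ih
    refine ⟨a + if w * t * w⁻¹ = cs.simple i then 1 else 0, fun e => ?_⟩
    rw [map_mul, lift_apply_simple, functionEnd_mul_apply, ha]
    simp [signedConj, mul_assoc, add_assoc]

/-- The cocycle identity. -/
theorem inversionParity_mul (w v t : W) :
    cs.inversionParity (w * v) t =
      cs.inversionParity v t + cs.inversionParity w (v * t * v⁻¹) := by
  conv_lhs => rw [inversionParity, map_mul, functionEnd_mul_apply,
    lift_signedConj_apply, lift_signedConj_apply, zero_add]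

@[simp]
theorem inversionParity_one (t : W) : cs.inversionParity 1 t = 0 := by
  simp [inversionParity]; rfl

open Classical in
theorem inversionParity_simple (i : B) (t : W) :
    cs.inversionParity (cs.simple i) t = if t = cs.simple i then 1 else 0 := by
  rw [inversionParity, lift_apply_simple]
  simp [signedConj]

theorem IsReflection.inversionParity_self {cs : CoxeterSystem M W} {t : W}
    (ht : cs.IsReflection t) : cs.inversionParity t t = 1 := by
  obtain ⟨v, i, rfl⟩ := ht
  have h := cs.inversionParity_mul v v⁻¹ (v * cs.simple i * v⁻¹)
  have e : v⁻¹ * (v * cs.simple i * v⁻¹) * v⁻¹⁻¹ = cs.simple i := by group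
  rw [mul_inv_cancel, inversionParity_one, e] at h
  rw [inversionParity_mul, e, inversionParity_mul, inversionParity_simple]
  simp only [if_true, mul_inv_cancel_right]
  rw [add_left_comm, ← h, add_zero]

theorem mem_rightInvSeq_of_inversionParity_ne_zero (ω : List B) {t : W}
    (h : cs.inversionParity (cs.wordProd ω) t ≠ 0) : t ∈ cs.rightInvSeq ω := by
  induction ω with
  | nil => simp at h
  | cons i ω ih =>
    rw [rightInvSeq, mem_cons]
    by_cases h0 : cs.inversionParity (cs.wordProd ω) t = 0
    · left
      rw [wordProd_cons, inversionParity_mul, h0, zero_add, inversionParity_simple] at h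
      have := of_not_not fun h' => h (if_neg h')
      rw [← this]; group
    · exact Or.inr (ih h0)

/-- The parity of `t` decides whether multiplication by `t` shortens `w`. -/
theorem IsReflection.length_mul_lt_iff {cs : CoxeterSystem M W} {t : W} (ht : cs.IsReflection t)
    (w : W) : cs.length (w * t) < cs.length w ↔ cs.inversionParity w t = 1 := by
  have key : ∀ w : W, cs.inversionParity w t ≠ 0 → cs.length (w * t) < cs.length w := by
    intro w h
    obtain ⟨ω, hω, rfl⟩ := cs.exists_isReduced w
    exact (cs.isRightInversion_of_mem_rightInvSeq hω
      (cs.mem_rightInvSeq_of_inversionParity_ne_zero ω h)).2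
  refine ⟨fun h => ?_, fun h => key w (by rw [h]; exact one_ne_zero)⟩
  by_contra hne
  have h0 : cs.inversionParity w t = 0 := by
    generalize cs.inversionParity w t = a at hne
    revert a; decide
  have := key (w * t) (by
    rw [inversionParity_mul, ht.inversionParity_self, mul_inv_cancel_right, h0, add_zero]
    exact one_ne_zero)
  rw [mul_assoc, ht.mul_self, mul_one] at this
  omega

theorem IsReflection.lt_length_mul_iff {cs : CoxeterSystem M W} {t : W} (ht : cs.IsReflection t)
    (w : W) : cs.length w < cs.length (w * t) ↔ cs.inversionParity w t = 0 := by
  have h := ht.length_mul_lt_iff w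
  have hne := ht.length_mul_left_ne w
  have h2 : ∀ a : ZMod 2, a = 0 ↔ ¬ a = 1 := by decide
  rw [h2, ← h]
  omega

/-- The strong exchange property: if a reflection `t` shortens `w = s_{i_1} ⋯ s_{i_k}`, where the
word need not be reduced, then `w t` is obtained by deleting one letter of the word. -/
theorem IsReflection.strong_exchange {cs : CoxeterSystem M W} {t : W} (ht : cs.IsReflection t)
    {ω : List B} (h : cs.length (cs.wordProd ω * t) < cs.length (cs.wordProd ω)) :
    ∃ (u v : List B) (i : B), ω = u ++ i :: v ∧
      t = (cs.wordProd v)⁻¹ * cs.simple i * cs.wordProd v ∧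
      cs.wordProd ω * t = cs.wordProd (u ++ v) := by
  have hmem := cs.mem_rightInvSeq_of_inversionParity_ne_zero ω
    (by rw [(ht.length_mul_lt_iff _).1 h]; exact one_ne_zero)
  obtain ⟨k, hk, rfl⟩ := List.mem_iff_getElem.mp hmem
  have hk' : k < ω.length := by simpa using hk
  refine ⟨ω.take k, ω.drop (k + 1), ω[k], by simp, ?_, ?_⟩
  · rw [cs.getElem_rightInvSeq ω k hk', getElem?_eq_getElem hk']
    rfl
  · rw [← List.getD_eq_getElem _ 1 hk, wordProd_mul_getD_rightInvSeq, eraseIdx_eq_take_drop_succ]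

end InversionParity

end CoxeterSystem

/-! ### The geometric representation -/

namespace CoxeterSystem

section GeometricRepresentation

variable {B : Type*} (M : CoxeterMatrix B)

/-- Twice the pairing with the `i`-th simple root. An entry `M i j = 0`, standing for `∞`, gives the
coefficient `-2 * cos 0 = -2`, and the diagonal entries `1` give `-2 * cos π = 2`. -/
noncomputable def rootPairing (i : B) : (B →₀ ℂ) →ₗ[ℂ] ℂ :=
  Finsupp.linearCombination ℂ fun j => -2 * Complex.cos (Real.pi / M i j)

/-- The simple reflection `z ↦ z - ⟨αᵢ, z⟩ αᵢ` of the geometric representation, with complex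
coefficients. -/
noncomputable def rootReflection (i : B) : Module.End ℂ (B →₀ ℂ) :=
  LinearMap.id - (rootPairing M i).smulRight (Finsupp.single i 1)

theorem rootReflection_apply (i : B) (z : B →₀ ℂ) :
    rootReflection M i z = z - rootPairing M i z • Finsupp.single i 1 := rfl

theorem rootPairing_single (i j : B) :
    rootPairing M i (Finsupp.single j 1) = -2 * Complex.cos (Real.pi / M i j) := by
  simp [rootPairing]

theorem rootPairing_single_self (i : B) : rootPairing M i (Finsupp.single i 1) = 2 := by
  simp [rootPairing_single]

open Polynomial in
/-- An element of a `ℂ`-algebra annihilated by `(X - 1)(X - ζ)(X - ζ⁻¹)` has order dividing `m`, if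
`ζ` is a primitive `m`-th root of unity with `m ≥ 3`, since the three factors are then distinct
factors of `X ^ m - 1`. -/
theorem pow_eq_one_of_annihilated {A : Type*} [Ring A] [Algebra ℂ A] {m : ℕ} (hm : 3 ≤ m) {ζ : ℂ}
    (hζ : IsPrimitiveRoot ζ m) {a : A}
    (h : aeval a ((X - C 1) * ((X - C ζ) * (X - C ζ⁻¹))) = 0) : a ^ m = 1 := by
  have h0 : ζ ≠ 0 := hζ.ne_zero (by omega)
  have h1 : ζ ≠ 1 := hζ.ne_one (by omega)
  have h2 : ζ ≠ ζ⁻¹ := fun e => by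
    have : ζ ^ 2 = 1 := by rw [pow_two]; nth_rewrite 1 [e]; exact inv_mul_cancel₀ h0
    have := Nat.le_of_dvd (by norm_num) (hζ.dvd_of_pow_eq_one 2 this)
    omega
  have h3 : ζ⁻¹ ≠ 1 := inv_ne_one.2 h1
  have hdvd : ∀ x : ℂ, x ^ m = 1 → X - C x ∣ (X ^ m - 1 : ℂ[X]) := fun x hx =>
    dvd_iff_isRoot.2 (by simp [hx])
  have hcop : ∀ x y : ℂ, x ≠ y → IsCoprime (X - C x) (X - C y) := fun x y hxy =>
    isCoprime_X_sub_C_of_isUnit_sub (sub_ne_zero.2 hxy).isUnit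
  have hall : (X - C 1) * ((X - C ζ) * (X - C ζ⁻¹)) ∣ (X ^ m - 1 : ℂ[X]) :=
    IsCoprime.mul_dvd (IsCoprime.mul_right (hcop _ _ h1.symm) (hcop _ _ h3.symm))
      (hdvd 1 (one_pow m))
      (IsCoprime.mul_dvd (hcop _ _ h2) (hdvd _ hζ.pow_eq_one)
        (hdvd _ (by rw [inv_pow, hζ.pow_eq_one, inv_one])))
  obtain ⟨q, hq⟩ := hall
  have := congrArg (aeval a) hq
  rw [map_mul, h, zero_mul] at this
  simpa [sub_eq_zero] using this

theorem isLiftable_rootReflection : M.IsLiftable (rootReflection M) := by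
  intro i j
  have hii := rootPairing_single_self M i
  have hjj := rootPairing_single_self M j
  have hij := rootPairing_single M i j
  have hji := rootPairing_single M j i
  rw [M.symmetric j i] at hji
  by_cases hd : i = j
  · subst hd
    rw [M.diagonal, pow_one]
    refine LinearMap.ext fun z => ?_
    simp only [Module.End.mul_apply, rootReflection_apply, map_sub, map_smul, hii,
      Module.End.one_apply]
    module
  generalize hm : M i j = m at *
  match m, hm with
  | 0, _ => rfl
  | 1, hm => exact absurd hm (M.off_diagonal i j hd)
  | 2, _ =>
    have hcos : Complex.cos (Real.pi / (2 : ℕ)) = 0 := by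
      exact_mod_cast Complex.cos_pi_div_two
    rw [hcos, mul_zero] at hij hji
    refine LinearMap.ext fun z => ?_
    simp only [pow_two, Module.End.mul_apply, rootReflection_apply, map_sub, map_smul, hii, hjj,
      hij, hji, Module.End.one_apply]
    module
  | m + 3, _ =>
    have hζ := Complex.isPrimitiveRoot_exp (m + 3) (by omega)
    refine pow_eq_one_of_annihilated (A := Module.End ℂ (B →₀ ℂ)) (by omega) hζ ?_
    set ζ := Complex.exp (2 * Real.pi * Complex.I / (m + 3 : ℕ)) with hζd
    set c := Complex.cos (Real.pi / (m + 3 : ℕ)) with hc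
    have hsum : ζ + ζ⁻¹ = 4 * c ^ 2 - 2 := by
      have : 2 * Complex.cos (2 * (Real.pi / (m + 3 : ℕ))) = ζ + ζ⁻¹ := by
        rw [Complex.two_cos, hζd, ← Complex.exp_neg]
        congr 2 <;> ring
      rw [← this, Complex.cos_two_mul]; ring
    have hmul : ζ * ζ⁻¹ = 1 := mul_inv_cancel₀ (Complex.exp_ne_zero _)
    have hpoly : (Polynomial.X - Polynomial.C ζ) * (Polynomial.X - Polynomial.C ζ⁻¹) =
        Polynomial.X ^ 2 - Polynomial.C (4 * c ^ 2 - 2) * Polynomial.X + 1 := by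
      rw [← hsum, ← Polynomial.C_1, ← hmul, Polynomial.C_mul, Polynomial.C_add]; ring
    rw [hpoly]
    refine LinearMap.ext fun z => ?_
    simp only [map_mul, map_add, map_sub, Polynomial.aeval_X, Polynomial.aeval_C, map_one,
      Module.End.mul_apply, pow_two, LinearMap.sub_apply, LinearMap.add_apply,
      Module.algebraMap_end_apply, Module.End.one_apply, LinearMap.zero_apply,
      rootReflection_apply, map_smul, hii, hjj, hij, hji]
    module

variable {M} {W : Type*} [Group W] (cs : CoxeterSystem M W)

/-- A simple reflection does not lie in the subgroup generated by the others: the geometric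
representation of a word without the letter `i` leaves all `i`-th coordinates unchanged. -/
theorem simple_ne_wordProd {i : B} {ω : List B} (h : i ∉ ω) : cs.simple i ≠ cs.wordProd ω := by
  set ρ := cs.lift ⟨rootReflection M, isLiftable_rootReflection M⟩
  have hω : ∀ z, ρ (cs.wordProd ω) z i = z i := by
    induction ω with
    | nil => simp
    | cons j ω ih =>
      simp only [List.mem_cons, not_or] at h
      intro z
      rw [wordProd_cons, map_mul, lift_apply_simple, Module.End.mul_apply, rootReflection_apply]
      simp [ih h.2, Finsupp.single_eq_of_ne h.1]
  intro e
  have h1 := hω (Finsupp.single i 1)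
  rw [← e, lift_apply_simple, rootReflection_apply, rootPairing_single_self] at h1
  norm_num at h1

theorem eq_nil_of_nodup_of_wordProd_eq_one {ω : List B} (hω : ω.Nodup)
    (h : cs.wordProd ω = 1) : ω = [] := by
  cases ω with
  | nil => rfl
  | cons i ω =>
    rw [wordProd_cons, mul_eq_one_iff_eq_inv, ← wordProd_reverse] at h
    exact absurd h (cs.simple_ne_wordProd (by simpa using (List.nodup_cons.1 hω).1))

end GeometricRepresentation

end CoxeterSystem

/-! ### Hurwitz equivalence of lists -/

section HurwitzEquivalence

variable {G : Type*} [Group G]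

/-- One Hurwitz move on a list, at any pair of adjacent entries. -/
inductive HurwitzStep : List G → List G → Prop
  | move (l₁ : List G) (a b : G) (l₂ : List G) :
      HurwitzStep (l₁ ++ a :: b :: l₂) (l₁ ++ a * b * a⁻¹ :: a :: l₂)

/-- Two lists are Hurwitz equivalent if they are joined by Hurwitz moves and their inverses. -/
def HurwitzEquiv : List G → List G → Prop := Relation.EqvGen HurwitzStep

theorem mul_zpow_of_involutions {r₁ r₂ : G} (h₁ : r₁ * r₁ = 1) (h₂ : r₂ * r₂ = 1) (k : ℤ) :
    r₁ * (r₁ * r₂) ^ k = (r₁ * r₂) ^ (-k) * r₁ := by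
  have : r₁ * (r₁ * r₂) * r₁⁻¹ = (r₁ * r₂)⁻¹ := by
    rw [mul_inv_rev, inv_eq_of_mul_eq_one_left h₁, inv_eq_of_mul_eq_one_left h₂, ← mul_assoc, h₁,
      one_mul]
  rw [zpow_neg, ← inv_zpow, ← this, conj_zpow, inv_mul_cancel_right]

namespace HurwitzEquiv

theorem refl (l : List G) : HurwitzEquiv l l := Relation.EqvGen.refl l

theorem symm {l l' : List G} (h : HurwitzEquiv l l') : HurwitzEquiv l' l :=
  Relation.EqvGen.symm _ _ h

theorem trans {l l' l'' : List G} (h : HurwitzEquiv l l') (h' : HurwitzEquiv l' l'') :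
    HurwitzEquiv l l'' := Relation.EqvGen.trans _ _ _ h h'

theorem step (a b : G) : HurwitzEquiv [a, b] [a * b * a⁻¹, a] :=
  Relation.EqvGen.rel _ _ (HurwitzStep.move [] a b [])

theorem append (l₁ l₂ : List G) {l l' : List G} (h : HurwitzEquiv l l') :
    HurwitzEquiv (l₁ ++ l ++ l₂) (l₁ ++ l' ++ l₂) := by
  induction h with
  | rel x y h =>
    obtain ⟨u, a, b, v⟩ := h
    have := HurwitzStep.move (l₁ ++ u) a b (v ++ l₂)
    simp only [List.append_assoc, List.cons_append] at this ⊢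
    exact Relation.EqvGen.rel _ _ this
  | refl x => exact refl _
  | symm x y _ ih => exact ih.symm
  | trans x y z _ _ ih ih' => exact ih.trans ih'

theorem length_eq {l l' : List G} (h : HurwitzEquiv l l') : l.length = l'.length := by
  induction h with
  | rel x y h => obtain ⟨u, a, b, v⟩ := h; simp
  | refl x => rfl
  | symm x y _ ih => exact ih.symm
  | trans x y z _ _ ih ih' => exact ih.trans ih'

theorem prod_eq {l l' : List G} (h : HurwitzEquiv l l') : l.prod = l'.prod := by
  induction h with
  | rel x y h => obtain ⟨u, a, b, v⟩ := h; simp [mul_assoc]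
  | refl x => rfl
  | symm x y _ ih => exact ih.symm
  | trans x y z _ _ ih ih' => exact ih.trans ih'

/-- A final entry may be moved to the front, past `v`, at the cost of conjugating it. -/
theorem append_conj (g : G) (v : List G) :
    HurwitzEquiv (v ++ [v.prod⁻¹ * g * v.prod]) (g :: v) := by
  induction v generalizing g with
  | nil => simpa using refl [g]
  | cons a v ih =>
    have h1 := (ih (a⁻¹ * g * a)).append [a] []
    have h2 := (step a (a⁻¹ * g * a)).append [] v
    rw [show a * (a⁻¹ * g * a) * a⁻¹ = g by group] at h2
    refine trans ?_ h2
    simpa [mul_assoc] using h1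

/-- Hurwitz moves on a pair of involutions, with `ρ = r₁ r₂` the rotation in the dihedral group
which they generate, lead to all pairs `(ρᵏ r₁, r₁ ρ¹⁻ᵏ)`. -/
theorem zpow_pair {r₁ r₂ : G} (h₁ : r₁ * r₁ = 1) (h₂ : r₂ * r₂ = 1) (k : ℤ) :
    HurwitzEquiv [r₁, r₂] [(r₁ * r₂) ^ k * r₁, r₁ * (r₁ * r₂) ^ (1 - k)] := by
  have hs : ∀ k : ℤ, HurwitzEquiv [(r₁ * r₂) ^ k * r₁, r₁ * (r₁ * r₂) ^ (1 - k)]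
      [(r₁ * r₂) ^ (k + 1) * r₁, r₁ * (r₁ * r₂) ^ (1 - (k + 1))] := fun k => by
    have h := step ((r₁ * r₂) ^ k * r₁) (r₁ * (r₁ * r₂) ^ (1 - k))
    have e : (r₁ * r₂) ^ k * r₁ * (r₁ * (r₁ * r₂) ^ (1 - k)) = r₁ * r₂ := by
      rw [mul_assoc, ← mul_assoc r₁ r₁, h₁, one_mul, ← zpow_add, add_sub_cancel, zpow_one]
    have e' : ((r₁ * r₂) ^ k * r₁)⁻¹ = (r₁ * r₂) ^ k * r₁ := by
      rw [mul_inv_rev, inv_eq_of_mul_eq_one_left h₁, ← zpow_neg, mul_zpow_of_involutions h₁ h₂,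
        neg_neg]
    rw [e, e', ← mul_assoc, ← zpow_one_add, add_comm 1 k] at h
    rwa [show 1 - (k + 1) = -k by ring, mul_zpow_of_involutions h₁ h₂ (-k), neg_neg]
  induction k with
  | zero =>
    have : r₁ * (r₁ * r₂) = r₂ := by rw [← mul_assoc, h₁, one_mul]
    simpa [this] using refl [r₁, r₂]
  | succ k ih => exact ih.trans (hs k)
  | pred k ih => simpa using ih.trans (by simpa using (hs (-k - 1)).symm)

end HurwitzEquiv

end HurwitzEquivalence

/-! ### Removing peaks from reflection factorizations -/

namespace CoxeterSystem

variable {B : Type*} {M : CoxeterMatrix B} {W : Type*} [Group W] {cs : CoxeterSystem M W}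

theorem _root_.HurwitzEquiv.forall_isReflection {l l' : List W} (h : HurwitzEquiv l l')
    (hl : ∀ t ∈ l, cs.IsReflection t) : ∀ t ∈ l', cs.IsReflection t := by
  suffices (∀ t ∈ l, cs.IsReflection t) ↔ ∀ t ∈ l', cs.IsReflection t from this.1 hl
  clear hl
  induction h with
  | rel x y h =>
    obtain ⟨u, a, b, v⟩ := h
    simp only [List.mem_append, List.mem_cons, or_imp, forall_and, forall_eq,
      isReflection_conj_iff]
    tauto
  | refl x => rfl
  | symm x y _ ih => exact ih.symm
  | trans x y z _ _ ih ih' => exact ih.trans ih'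

/-- Let `r₁ ≠ r₂` be reflections. Among the steps `ρᵏ r₁` to which Hurwitz moves can change the
first step of the path `x, x r₁, x r₁ r₂` (see `HurwitzEquiv.zpow_pair`), one leads to an element
that is shorter than at least one of the two ends. Otherwise the inversions among the `ρᵏ r₁` of an element of
`⟨r₁, r₂⟩` would be all of them or none, according to its parity. But a shortest conjugator `v`, with
`v⁻¹ sᵢ v = ρᵏ r₁`, has none of them as inversions, and `sᵢ v` has exactly one, as passing from `v` to
`sᵢ v` changes a single inversion. -/
theorem exists_length_mul_lt_max {r₁ r₂ : W} (h₁ : cs.IsReflection r₁) (h₂ : cs.IsReflection r₂)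
    (hne : r₁ ≠ r₂) (x : W) :
    ∃ k : ℤ, cs.length (x * ((r₁ * r₂) ^ k * r₁)) <
      max (cs.length x) (cs.length (x * (r₁ * r₂))) := by
  set ρ := r₁ * r₂ with hρ
  have hflip : ∀ k : ℤ, r₁ * ρ ^ k = ρ ^ (-k) * r₁ :=
    mul_zpow_of_involutions h₁.mul_self h₂.mul_self
  have hτ : ∀ k l : ℤ, (ρ ^ k * r₁) * (ρ ^ l * r₁) = ρ ^ (k - l) := fun k l => by
    rw [mul_assoc, ← mul_assoc r₁, hflip, mul_assoc, h₁.mul_self, mul_one, ← zpow_add,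
      sub_eq_add_neg]
  have hrefl : ∀ k : ℤ, cs.IsReflection (ρ ^ k * r₁) := fun k =>
    (HurwitzEquiv.zpow_pair h₁.mul_self h₂.mul_self k).forall_isReflection (by simp [h₁, h₂]) _
      (by simp [hρ])
  by_contra! hcon
  -- then no `ρᵏ r₁` is an inversion of `x` or of `x ρ`
  have hx : ∀ k : ℤ, cs.inversionParity x (ρ ^ k * r₁) = 0 := fun k => by
    rw [← (hrefl k).lt_length_mul_iff]
    exact lt_of_le_of_ne ((le_max_left _ _).trans (hcon k)) ((hrefl k).length_mul_left_ne x).symm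
  have hxρ : ∀ k : ℤ, cs.inversionParity (x * ρ) (ρ ^ k * r₁) = 0 := fun k => by
    rw [← (hrefl k).lt_length_mul_iff]
    refine lt_of_le_of_ne ?_ ((hrefl k).length_mul_left_ne _).symm
    have := hcon (1 + k)
    rw [zpow_one_add, mul_assoc ρ, ← mul_assoc x ρ] at this
    exact (le_max_right _ _).trans this
  -- so rotations have no inversions among the `ρᵏ r₁`, and each `ρᵏ r₁` has all of them
  have hconj : ∀ k : ℤ, ρ * (ρ ^ k * r₁) * ρ⁻¹ = ρ ^ (k + 2) * r₁ := fun k => by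
    have h := hflip (-1)
    rw [zpow_neg_one, neg_neg, zpow_one] at h
    rw [← mul_assoc, mul_assoc _ r₁, h, ← mul_assoc, ← zpow_one_add, ← zpow_add_one]
    congr 2; ring
  have hρ1 : ∀ k : ℤ, cs.inversionParity ρ (ρ ^ k * r₁) = 0 := fun k => by
    have h := cs.inversionParity_mul x ρ (ρ ^ k * r₁)
    rw [hxρ, hconj, hx, add_zero] at h
    exact h.symm
  have hρk : ∀ j k : ℤ, cs.inversionParity (ρ ^ j) (ρ ^ k * r₁) = 0 := fun j => by
    induction j with
    | zero => simp
    | succ j ih =>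
      intro k
      rw [zpow_add_one, inversionParity_mul, hρ1, hconj, ih, add_zero]
    | pred j ih =>
      intro k
      have h := cs.inversionParity_mul (ρ ^ (-(j : ℤ) - 1)) ρ (ρ ^ (k - 2) * r₁)
      rw [← zpow_add_one, sub_add_cancel, ih, hconj, hρ1, zero_add, sub_add_cancel] at h
      exact h.symm
  have hall : ∀ k l : ℤ, cs.inversionParity (ρ ^ k * r₁) (ρ ^ l * r₁) = 1 := by
    have h0 : ∀ k l : ℤ, cs.inversionParity (ρ ^ k * r₁) (ρ ^ l * r₁) =
        cs.inversionParity r₁ (ρ ^ l * r₁) := fun k l => by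
      have : r₁ * (ρ ^ l * r₁) * r₁⁻¹ = ρ ^ (-l) * r₁ := by
        rw [← mul_assoc, hflip, mul_inv_cancel_right]
      rw [inversionParity_mul, this, hρk, add_zero]
    intro k l
    rw [h0, ← h0 l, (hrefl l).inversionParity_self]
  -- write some `ρᵏ r₁` as `v⁻¹ sᵢ v` with `v` as short as possible
  have hex : ∃ (n : ℕ) (ω : List B) (i : B) (k : ℤ), ω.length = n ∧
      (cs.wordProd ω)⁻¹ * cs.simple i * cs.wordProd ω = ρ ^ k * r₁ := by
    obtain ⟨w, i, hw⟩ := h₁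
    obtain ⟨ω, hω⟩ := cs.wordProd_surjective w⁻¹
    exact ⟨_, ω, i, 0, rfl, by rw [hω, hw]; group⟩
  classical
  obtain ⟨ω, i, k, hlen, hv⟩ := Nat.find_spec hex
  have hmin : ∀ l : ℤ, cs.inversionParity (cs.wordProd ω) (ρ ^ l * r₁) = 0 := fun l => by
    by_contra h
    obtain ⟨j, hj, hjt⟩ := List.mem_iff_getElem.mp
      (cs.mem_rightInvSeq_of_inversionParity_ne_zero ω h)
    have hj' : j < ω.length := by simpa using hj
    rw [cs.getElem_rightInvSeq ω j hj', List.getElem?_eq_getElem hj'] at hjt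
    have : (ω.drop (j + 1)).length < Nat.find hex := by
      rw [← hlen, List.length_drop]; omega
    exact Nat.find_min hex this ⟨_, _, l, rfl, hjt⟩
  -- among the `ρˡ r₁`, the only inversion of `sᵢ v` is `ρᵏ r₁`; but `sᵢ v = v ρᵏ r₁` has them all
  have hone : ∀ l : ℤ, ρ ^ l * r₁ = ρ ^ k * r₁ := fun l => by
    have e : cs.simple i * cs.wordProd ω = cs.wordProd ω * (ρ ^ k * r₁) := by rw [← hv]; group
    have h := congrArg (cs.inversionParity · (ρ ^ l * r₁)) e
    have e2 : ρ ^ k * r₁ * (ρ ^ l * r₁) * (ρ ^ k * r₁)⁻¹ = ρ ^ (k - l + k) * r₁ := by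
      rw [hτ, (hrefl k).inv, ← mul_assoc, zpow_add]
    simp only [inversionParity_mul, hmin, hall, e2, add_zero, zero_add,
      inversionParity_simple] at h
    have h' := of_not_not fun h' => by rw [if_neg h'] at h; exact zero_ne_one h
    rw [← hv, ← h']; group
  apply hne
  have h := (hone 1).trans (hone 0).symm
  rw [zpow_one, zpow_zero, one_mul, mul_eq_right, hρ] at h
  rw [eq_inv_of_mul_eq_one_left h, h₂.inv]

variable (cs) in
/-- The sum of the lengths of the elements `x a₁, x a₁ a₂, …` passed by the path from `x` with steps
`a₁, a₂, …`. -/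
noncomputable def pathWeight : W → List W → ℕ
  | _, [] => 0
  | x, a :: l => cs.length (x * a) + pathWeight (x * a) l

theorem pathWeight_append (x : W) (l₁ l₂ : List W) :
    cs.pathWeight x (l₁ ++ l₂) = cs.pathWeight x l₁ + cs.pathWeight (x * l₁.prod) l₂ := by
  induction l₁ generalizing x with
  | nil => simp [pathWeight]
  | cons a l₁ ih => simp [pathWeight, ih, mul_assoc, add_assoc]

variable (cs) in
/-- No partial product of `l`, other than the first and the last, is longer than both of its
neighbours. -/
def IsPeakless (l : List W) : Prop :=
  ∀ l₁ a b l₂, l = l₁ ++ a :: b :: l₂ →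
    cs.length (l₁.prod * a) ≤ max (cs.length l₁.prod) (cs.length (l₁.prod * (a * b)))

/-- Hurwitz moves lead to a factorization without peaks or with two equal adjacent factors:
a peak between two different reflections can be removed by moves in the dihedral group
which they generate, and this lowers the `pathWeight`. -/
theorem exists_isPeakless_or_repeat (l : List W) (hl : ∀ t ∈ l, cs.IsReflection t) :
    (∃ l', HurwitzEquiv l l' ∧ cs.IsPeakless l') ∨
      ∃ l₁ a l₂, HurwitzEquiv l (l₁ ++ a :: a :: l₂) := by
  induction h : cs.pathWeight 1 l using Nat.strong_induction_on generalizing l with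
  | _ n ih =>
  subst h
  by_cases hp : cs.IsPeakless l
  · exact Or.inl ⟨l, .refl l, hp⟩
  simp only [IsPeakless, not_forall, not_le] at hp
  obtain ⟨l₁, a, b, l₂, rfl, hpeak⟩ := hp
  by_cases hab : a = b
  · subst hab
    exact Or.inr ⟨l₁, a, l₂, .refl _⟩
  have ha : cs.IsReflection a := hl a (by simp)
  have hb : cs.IsReflection b := hl b (by simp)
  obtain ⟨k, hk⟩ := exists_length_mul_lt_max ha hb hab l₁.prod
  have hpair := HurwitzEquiv.zpow_pair ha.mul_self hb.mul_self k
  have hprod := hpair.prod_eq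
  generalize (a * b) ^ k * a = a' at hk hpair hprod
  generalize a * (a * b) ^ (1 - k) = b' at hpair hprod
  simp only [List.prod_cons, List.prod_nil, mul_one] at hprod
  have hequiv : HurwitzEquiv (l₁ ++ a :: b :: l₂) (l₁ ++ a' :: b' :: l₂) := by
    simpa using hpair.append l₁ l₂
  have hlt : cs.pathWeight 1 (l₁ ++ a' :: b' :: l₂) < cs.pathWeight 1 (l₁ ++ a :: b :: l₂) := by
    simp only [pathWeight_append, pathWeight, one_mul, mul_assoc l₁.prod, hprod]
    omega
  rcases ih _ hlt _ (hequiv.forall_isReflection hl) rfl with ⟨l', h, h'⟩ | ⟨u, c, v, h⟩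
  · exact Or.inl ⟨l', hequiv.trans h, h'⟩
  · exact Or.inr ⟨u, c, v, hequiv.trans h⟩

theorem IsPeakless.of_append {l l' : List W} (h : cs.IsPeakless (l ++ l')) : cs.IsPeakless l :=
  fun l₁ a b l₂ e => h l₁ a b (l₂ ++ l') (by simp [e])

/-- A path from `1` starts upwards, so without peaks it never turns down. -/
theorem IsPeakless.length_prod_lt {l : List W} {t : W} (h : cs.IsPeakless (l ++ [t]))
    (hl : ∀ r ∈ l ++ [t], cs.IsReflection r) : cs.length l.prod < cs.length (l.prod * t) := by
  induction l using List.reverseRecOn generalizing t with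
  | nil =>
    have := (hl t (by simp)).length_mul_left_ne 1
    simp only [length_one] at this
    simpa using Nat.pos_of_ne_zero this
  | append_singleton l a ih =>
    have h1 := ih h.of_append fun r hr => hl r (List.mem_append_left _ hr)
    have h2 := h l a t [] (by simp)
    have h3 := (hl t (by simp)).length_mul_left_ne (l ++ [a]).prod
    simp only [List.prod_append, List.prod_singleton, mul_assoc] at h3 ⊢
    omega

/-- The last step of the path shortens the product of a word with distinct letters to the product
of the word with one letter deleted, by strong exchange, and the last reflection can be moved to
the place of the deleted letter. -/
theorem IsPeakless.hurwitzEquiv_of_nodup {l : List W} (h : cs.IsPeakless l)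
    (hl : ∀ r ∈ l, cs.IsReflection r) {ω : List B} (hω : ω.Nodup) (hprod : l.prod = cs.wordProd ω) :
    HurwitzEquiv l (ω.map cs.simple) := by
  induction l using List.reverseRecOn generalizing ω with
  | nil =>
    rw [cs.eq_nil_of_nodup_of_wordProd_eq_one hω hprod.symm]
    exact .refl _
  | append_singleton l t ih =>
    have ht : cs.IsReflection t := hl t (by simp)
    have hlt := h.length_prod_lt hl
    rw [List.prod_append, List.prod_singleton] at hprod
    have hl' : l.prod = cs.wordProd ω * t := by rw [← hprod, mul_assoc, ht.mul_self, mul_one]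
    rw [hprod, hl'] at hlt
    obtain ⟨u, v, i, rfl, rfl, hdel⟩ := ht.strong_exchange hlt
    have hnodup : (u ++ v).Nodup := hω.sublist (by simp)
    have h1 := (ih h.of_append (fun r hr => hl r (List.mem_append_left _ hr)) hnodup
      (hl'.trans hdel)).append [] [(cs.wordProd v)⁻¹ * cs.simple i * cs.wordProd v]
    have h2 := (HurwitzEquiv.append_conj (cs.simple i) (v.map cs.simple)).append
      (u.map cs.simple) []
    simp only [List.map_append, List.nil_append, List.append_nil, List.append_assoc,
      List.map_cons] at h1 h2 ⊢
    exact h1.trans h2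

/-- A factorization into at most `|ω|` reflections of the product of a word `ω` with distinct
letters is Hurwitz equivalent to the word itself; in particular it has exactly `|ω|` factors. -/
theorem hurwitzEquiv_of_length_le {l : List W} (hl : ∀ r ∈ l, cs.IsReflection r) {ω : List B}
    (hω : ω.Nodup) (hprod : l.prod = cs.wordProd ω) (hle : l.length ≤ ω.length) :
    HurwitzEquiv l (ω.map cs.simple) := by
  induction h : l.length using Nat.strong_induction_on generalizing l with
  | _ n ih =>
  subst h
  rcases exists_isPeakless_or_repeat l hl with ⟨l', h, hp⟩ | ⟨u, a, v, h⟩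
  · exact h.trans (hp.hurwitzEquiv_of_nodup (h.forall_isReflection hl) hω (h.prod_eq ▸ hprod))
  · -- cancelling the repeated reflection leaves a factorization that is too short
    exfalso
    have hr := h.forall_isReflection hl
    have hlen := h.length_eq
    have hp := h.prod_eq
    simp only [List.prod_append, List.prod_cons, ← mul_assoc a, (hr a (by simp)).mul_self,
      one_mul] at hp
    simp only [List.length_append, List.length_cons] at hlen
    have := (ih (u ++ v).length (by simp; omega) (l := u ++ v)
      (fun r hmem => hr r (by simp at hmem ⊢; tauto))
      (by rw [List.prod_append, ← hp, hprod]) (by simp; omega) rfl).length_eq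
    simp at this
    omega

end CoxeterSystem

/-! ### The Hurwitz action of the braid group -/

section HurwitzAction

variable {G : Type*} [Group G] {m : ℕ}

theorem hurwitzAction_of (i : Fin (m - 1)) :
    hurwitzAction G m (PresentedGroup.of i) = hurwitzPerm i := PresentedGroup.toGroup.of _

theorem ofFn_hurwitzMove {g : Fin m → G} {u v : List G} {a b : G}
    (h : List.ofFn g = u ++ a :: b :: v) {i : Fin (m - 1)} (hi : i.val = u.length) :
    List.ofFn (hurwitzMove i g) = u ++ a * b * a⁻¹ :: a :: v := by
  have hm : m = u.length + (v.length + 2) := by simpa using congrArg List.length h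
  have hg : ∀ k : Fin m, g k = (u ++ a :: b :: v)[k.val]'(by simp; omega) := fun k => by
    simp [← h]
  apply List.ext_getElem
  · simp [hm, add_assoc]
  intro k h₁ h₂
  rw [List.getElem_ofFn]
  simp only [hurwitzMove, braidLeft, braidRight, Fin.mk.injEq, hg, hi]
  rcases lt_trichotomy k u.length with hk | rfl | hk
  · simp [hk, hk.ne, show k ≠ u.length + 1 by omega]
  · simp
  · obtain ⟨j, rfl⟩ := Nat.exists_eq_add_of_lt hk
    cases j with
    | zero => simp
    | succ j => simp [add_assoc, List.getElem_append_right]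

theorem hurwitzStep_hurwitzMove (i : Fin (m - 1)) (g : Fin m → G) :
    HurwitzStep (List.ofFn g) (List.ofFn (hurwitzMove i g)) := by
  have hi : i.val + 1 < (List.ofFn g).length := by rw [List.length_ofFn]; omega
  have h : List.ofFn g = (List.ofFn g).take i ++ (List.ofFn g)[i.val] ::
      (List.ofFn g)[i.val + 1] :: (List.ofFn g).drop (i + 2) := by
    rw [← List.drop_eq_getElem_cons, ← List.drop_eq_getElem_cons, List.take_append_drop]
  rw [ofFn_hurwitzMove h (by rw [List.length_take]; omega)]
  nth_rewrite 1 [h]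
  exact .move _ _ _ _

theorem HurwitzStep.exists_hurwitzMove {g g' : Fin m → G}
    (h : HurwitzStep (List.ofFn g) (List.ofFn g')) : ∃ i, hurwitzMove i g = g' := by
  generalize hl : List.ofFn g = l at h
  generalize hl' : List.ofFn g' = l' at h
  obtain ⟨u, a, b, v⟩ := h
  have hm : m = u.length + (v.length + 2) := by simpa using congrArg List.length hl
  exact ⟨⟨u.length, by omega⟩, List.ofFn_injective ((ofFn_hurwitzMove hl rfl).trans hl'.symm)⟩

theorem HurwitzEquiv.exists_hurwitzAction {g g' : Fin m → G}
    (h : HurwitzEquiv (List.ofFn g) (List.ofFn g')) :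
    ∃ b : BraidGroup m, hurwitzAction G m b g = g' := by
  generalize hl : List.ofFn g = l at h
  generalize hl' : List.ofFn g' = l' at h
  induction h generalizing g g' with
  | rel x y h =>
    subst hl hl'
    obtain ⟨i, rfl⟩ := h.exists_hurwitzMove
    exact ⟨.of i, by rw [hurwitzAction_of]; rfl⟩
  | refl x =>
    exact ⟨1, by rw [map_one, Equiv.Perm.one_apply]; exact List.ofFn_injective (hl.trans hl'.symm)⟩
  | symm x y _ ih =>
    obtain ⟨b, rfl⟩ := ih hl' hl
    exact ⟨b⁻¹, by rw [map_inv, ← Equiv.Perm.mul_apply, inv_mul_cancel, Equiv.Perm.one_apply]⟩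
  | trans x y z hxy hyz ih ih' =>
    have hlen : y.length = m := by
      have := length_eq hxy
      rw [← hl, List.length_ofFn] at this
      exact this.symm
    obtain ⟨f, rfl⟩ : ∃ f : Fin m → G, List.ofFn f = y := by
      subst hlen; exact ⟨y.get, List.ofFn_get y⟩
    obtain ⟨b, rfl⟩ := ih hl rfl
    obtain ⟨c, rfl⟩ := ih' rfl hl'
    exact ⟨c * b, by rw [map_mul, Equiv.Perm.mul_apply]⟩

theorem hurwitzEquiv_hurwitzAction (b : BraidGroup m) (g : Fin m → G) :
    HurwitzEquiv (List.ofFn g) (List.ofFn (hurwitzAction G m b g)) := by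
  have hb : b ∈ Subgroup.closure (Set.range PresentedGroup.of) := by
    rw [PresentedGroup.closure_range_of]; trivial
  induction hb using Subgroup.closure_induction generalizing g with
  | mem x hx =>
    obtain ⟨i, rfl⟩ := hx
    rw [hurwitzAction_of]
    exact .rel _ _ (hurwitzStep_hurwitzMove i g)
  | one => rw [map_one]; exact .refl _
  | mul x y _ _ hx hy => rw [map_mul, Equiv.Perm.mul_apply]; exact (hy g).trans (hx _)
  | inv x _ hx =>
    have := hx ((hurwitzAction G m x)⁻¹ g)
    rw [← Equiv.Perm.mul_apply, mul_inv_cancel, Equiv.Perm.one_apply] at this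
    rw [map_inv]
    exact this.symm

end HurwitzAction

theorem theorem2 {n : ℕ} {M : CoxeterMatrix (Fin n)} {W : Type*} [Group W]
    (cs : CoxeterSystem M W) :
    -- if `m ≤ n` and `t_m ⋯ t_1 = C` for reflections `t_1, …, t_m`, then `m = n`
    (∀ m : ℕ, m ≤ n → ∀ t : Fin m → W, (∀ i, cs.IsReflection (t i)) →
      (List.ofFn t).reverse.prod = cs.coxeterElement → m = n) ∧
    -- if `t_n ⋯ t_1 = C`, some braid transforms `(t_n, …, t_1)` into `(s_1, …, s_n)`
    (∀ t : Fin n → W, (∀ i, cs.IsReflection (t i)) →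
      (List.ofFn t).reverse.prod = cs.coxeterElement →
      ∃ b : BraidGroup n, hurwitzAction W n b (fun i => t i.rev) = cs.simple) ∧
    -- the braid group acts on the (nonempty) set of sequences of `n` reflections with product `C`
    (cs.reflectionFactorizations n cs.coxeterElement).Nonempty ∧
    (∀ b : BraidGroup n, ∀ r ∈ cs.reflectionFactorizations n cs.coxeterElement,
      hurwitzAction W n b r ∈ cs.reflectionFactorizations n cs.coxeterElement) ∧
    -- and this action is transitive
    (∀ r ∈ cs.reflectionFactorizations n cs.coxeterElement,
      ∀ r' ∈ cs.reflectionFactorizations n cs.coxeterElement,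
      ∃ b : BraidGroup n, hurwitzAction W n b r = r') := by
  have hmap : (List.finRange n).map cs.simple = List.ofFn cs.simple := List.ofFn_eq_map.symm
  have key : ∀ l : List W, (∀ r ∈ l, cs.IsReflection r) → l.prod = cs.coxeterElement →
      l.length ≤ n → HurwitzEquiv l (List.ofFn cs.simple) := fun l hl hprod hlen => by
    rw [← hmap]
    refine CoxeterSystem.hurwitzEquiv_of_length_le hl (List.nodup_finRange n) ?_ (by simpa)
    rw [hprod, CoxeterSystem.wordProd, hmap, CoxeterSystem.coxeterElement]
  have key' : ∀ r ∈ cs.reflectionFactorizations n cs.coxeterElement,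
      ∃ b : BraidGroup n, hurwitzAction W n b r = cs.simple := fun r hr =>
    (key _ (by simpa [List.forall_mem_ofFn_iff] using hr.1) hr.2 (by simp)).exists_hurwitzAction
  refine ⟨fun m hm t ht hprod => ?_, fun t ht hprod => key' _ ⟨fun i => ht _, ?_⟩,
    ⟨cs.simple, cs.isReflection_simple, rfl⟩, fun b r hr => ?_, fun r hr r' hr' => ?_⟩
  · simpa using (key _ (by simpa [List.forall_mem_ofFn_iff] using ht) hprod (by simpa)).length_eq
  · rw [← hprod]
    congr 1
    apply List.ext_getElem
    · simp
    · intro k _ _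
      simp only [List.getElem_ofFn, List.getElem_reverse, List.length_ofFn, Fin.rev]
      congr 2
      omega
  · have h := hurwitzEquiv_hurwitzAction b r
    refine ⟨fun i => ?_, h.prod_eq ▸ hr.2⟩
    exact h.forall_isReflection (by simpa [List.forall_mem_ofFn_iff] using hr.1) _
      (List.mem_ofFn.2 ⟨i, rfl⟩)
  · obtain ⟨b, hb⟩ := key' r hr
    obtain ⟨c, hc⟩ := key' r' hr'
    exact ⟨c⁻¹ * b, by rw [map_mul, Equiv.Perm.mul_apply, hb, ← hc, map_inv,
      ← Equiv.Perm.mul_apply, inv_mul_cancel, Equiv.Perm.one_apply]⟩
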